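/- Let $K_+,K_-\subset\mathbb{R}^3$ be two nondegenerate closed tetrahedra that share a common face $F=K_+\cap K_-=\mathrm{conv}\{Q_1,Q_2,Q_3\}$. For each $K=\mathrm{conv}\{P_1,\dots,P_4\}\in\{K_+,K_-\}$ let $c_K$ be a point in the interior of $K$ and let $c_{K,m}$ ($m=1,\dots,4$) be a point in the relative interior of the face of $K$ opposite to $P_m$. Let the Worsey--Farin partition $\widehat{\mathcal T}(K)$ consist of the twelve tetrahedra $\mathrm{conv}\{P_j,P_k,c_K,c_{K,m}\}$ with $1\le j<k\le 4$ and $m\in\{1,2,3,4\}\setminus\{j,k\}$, and let $$\mathrm{WF}(K):=C^1(K)\cap P_3(\widehat{\mathcal T}(K))$$ be the space of $C^1$ functions on $K$ that are polynomials of total degree at most three on each $T\in\widehat{\mathcal T}(K)$. Suppose that the two partitions use the same center $c_F$ in the common face $F$, and that $c_F$, $c_{K_+}$, $c_{K_-}$ lie on one straight line. Let $f_+\in \mathrm{WF}(K_+)$ and $f_-\in \mathrm{WF}(K_-)$ agree in the $18$ degrees of freedom attached to $F$, that is, $$f_+(Q_\ell)=f_-(Q_\ell),\qquad \nabla f_+(Q_\ell)=\nabla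 f_-(Q_\ell),\qquad \nabla f_+(Q_{jk})\times\tau_{jk}=\nabla f_-(Q_{jk})\times\tau_{jk}$$ for all $1\le \ell\le 3$ and $1\le j<k\le 3$, where $Q_{jk}=(Q_j+Q_k)/2$ and $\tau_{jk}=(Q_k-Q_j)/|Q_k-Q_j|$. Then $f_\pm$ together form a $C^1$ function: there is $f\in C^1(K_+\cup K_-)$ with $f|_{K_+}=f_+$ and $f|_{K_-}=f_-$; in particular $f$ is continuously differentiable on the patch $\omega(F)=\mathrm{int}(K_+\cup K_-)$. -/

import Mathlib

open scoped Matrix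

namespace WorseyFarin

/-- Euclidean three-space. -/
abbrev E3 : Type := EuclideanSpace ℝ (Fin 3)

/-- A (nondegenerate) tetrahedron with an ordered list of four vertices; the closed point set is
`K.closedInterior = conv {Q₀, Q₁, Q₂, Q₃}`. -/
abbrev Tetrahedron : Type := Affine.Simplex ℝ E3 3

/-- A (nondegenerate) triangle in three-space. -/
abbrev Triangle : Type := Affine.Simplex ℝ E3 2

/-- `F` is the face of `K` opposite to the vertex number `m` (equality of vertex sets; the ordering
of the vertices is irrelevant). -/
def IsFaceOpposite (F : Triangle) (K : Tetrahedron) (m : Fin 4) : Prop :=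
  Set.range F.points = Set.range (K.faceOpposite m).points

/-- The data of a Worsey-Farin partition of `K`: a centre in the interior of `K` and, for each `m`,
a centre in the relative interior of the face opposite to the vertex number `m`. Here
`Affine.Simplex.interior` is the set of points all of whose barycentric coordinates lie
in `(0, 1)`. -/
structure Centers (K : Tetrahedron) where
  /-- the centre of the tetrahedron -/
  cK : E3
  /-- the centres of the faces -/
  cF : Fin 4 → E3
  cK_mem : cK ∈ K.interior
  cF_mem : ∀ m, cF m ∈ (K.faceOpposite m).interior

/-- The Worsey-Farin partition: the `12` subtetrahedra `conv {Q_j, Q_k, c_K, c_m}` with `j < k`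
and `m` different from `j` and `k`. -/
def partition {K : Tetrahedron} (c : Centers K) : Set (Set E3) :=
  {T | ∃ j k m : Fin 4, j < k ∧ m ≠ j ∧ m ≠ k ∧
    T = convexHull ℝ {K.points j, K.points k, c.cK, c.cF m}}

/-- `f` coincides on `T` with a polynomial of total degree at most `d`. -/
def IsPolyOn (d : ℕ) (f : E3 → ℝ) (T : Set E3) : Prop :=
  ∃ p : MvPolynomial (Fin 3) ℝ, p.totalDegree ≤ d ∧
    ∀ x ∈ T, f x = MvPolynomial.eval (fun i => x i) p

/-- Membership in the local Worsey-Farin space `WF(K) = C¹(K) ∩ P₃(partition)`. Only the values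
of `f` on the closed tetrahedron matter. Since `K` is convex with nonempty interior,
`ContDiffOn ℝ 1 f K` says that `f` is `C¹` in the interior and that `f` and its gradient extend
continuously up to the boundary of `K`. -/
def IsWF (K : Tetrahedron) (c : Centers K) (f : E3 → ℝ) : Prop :=
  ContDiffOn ℝ 1 f K.closedInterior ∧ ∀ T ∈ partition c, IsPolyOn 3 f T

/-- The gradient of a function in `C¹(K)`, at points of the closed tetrahedron `K` (at boundary
points this is the continuous extension of the gradient from the interior). -/
noncomputable def grad (K : Tetrahedron) (f : E3 → ℝ) (x : E3) : E3 :=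
  gradientWithin f K.closedInterior x

/-- The unit tangent vector of the edge from the vertex `j` to the vertex `k` of a triangle. -/
noncomputable def unitTangent (F : Triangle) (j k : Fin 3) : E3 :=
  ‖F.points k - F.points j‖⁻¹ • (F.points k - F.points j)

/-- The cross product of vectors in Euclidean three-space. -/
def cross (a b : E3) : E3 := WithLp.toLp 2 (a.ofLp ⨯₃ b.ofLp)

/-- The `18` degrees of freedom attached to the common face `F` coincide for `f₁` on `K₁` and
`f₂` on `K₂`: the values and the gradients at the three vertices, and the components of the
gradients perpendicular to the edge at the three edge midpoints. -/
def FaceDofsAgree (F : Triangle) (K₁ K₂ : Tetrahedron) (f₁ f₂ : E3 → ℝ) : Prop :=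
  (∀ l : Fin 3, f₁ (F.points l) = f₂ (F.points l)) ∧
  (∀ l : Fin 3, grad K₁ f₁ (F.points l) = grad K₂ f₂ (F.points l)) ∧
  (∀ j k : Fin 3, j < k →
    cross (grad K₁ f₁ (midpoint ℝ (F.points j) (F.points k))) (unitTangent F j k) =
    cross (grad K₂ f₂ (midpoint ℝ (F.points j) (F.points k))) (unitTangent F j k))

end WorseyFarin

/-!
Let `Q₀, Q₁, Q₂` be the vertices of the common face `F`, let `c` be its centre, and let `d = c_K - c`.
The centres being collinear, `d` is the same direction for both tetrahedra up to a factor. The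
functions glue to a `C¹` function (`contDiffOn_one_piecewise_union`) as soon as their values and their
derivatives agree on `F`, and for this it suffices to compare, on `F`, the values and the derivatives
in the direction `d` (`eq_on_face`).

On `F` the partitions induce the Clough-Tocher split into the triangles `conv {c, Qᵢ, Qᵢ₊₁}`.

* The jump of the values is a `C¹` piecewise cubic on this split. Its values and gradients vanish at
  the vertices. Along an edge it is therefore a cubic with two double zeros, so its tangential
  derivative vanishes at the midpoint; together with the edge condition this makes the whole
  gradient jump vanish there. Unisolvence of the Hsieh-Clough-Tocher element (`cubic_eq_zero`) gives
  zero.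
* The derivative in the direction `d` is piecewise quadratic on `F`. Across an interior triangle
  `conv {c, c_K, Qᵢ}` a `C¹` function jumps by a multiple of `ℓ²` where `ℓ` vanishes on the plane of
  that triangle. This plane contains `d`, so the derivative in the direction `d` jumps by a multiple
  of `ℓ²` as well, that is, it is again `C¹` (`exists_face_coeffs`). A `C¹` piecewise quadratic on the
  Clough-Tocher split is a single quadratic, hence determined by its values at the vertices and the
  midpoints (`quad_eq_zero`), where the gradients agree.

All of this is done with explicit coefficients in the coordinates
`c + s (Qᵢ - c) + t (Qᵢ₊₁ - c) + z d`, with indices `i` modulo `3`.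
-/

open scoped Matrix

namespace WorseyFarin

/-! ### Piecewise polynomials on the Clough-Tocher split -/

theorem sum_cyclic {M : Type*} [AddCommMonoid M] (g : Fin 3 → M) (k : Fin 3) :
    g k + g (k + 1) + g (k + 2) = ∑ i, g i := by
  rw [Fin.sum_univ_three]
  fin_cases k
  · rfl
  · exact (add_rotate _ _ _).symm
  · exact add_rotate _ _ _

/-- The bivariate quadratic polynomial with coefficients `b` in the order
`1, s, t, s², st, t²`. -/
def quad (b : Fin 6 → ℝ) (s t : ℝ) : ℝ :=
  b 0 + b 1 * s + b 2 * t + b 3 * s ^ 2 + b 4 * (s * t) + b 5 * t ^ 2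

/-- The bivariate cubic polynomial with coefficients `a` in the order
`1, s, t, s², st, t², s³, s²t, st², t³`. -/
def cubic (a : Fin 10 → ℝ) (s t : ℝ) : ℝ :=
  a 0 + a 1 * s + a 2 * t + a 3 * s ^ 2 + a 4 * (s * t) + a 5 * t ^ 2 +
    a 6 * s ^ 3 + a 7 * (s ^ 2 * t) + a 8 * (s * t ^ 2) + a 9 * t ^ 3

/-- The partial derivative of `cubic a` in its first variable. -/
def cubicS (a : Fin 10 → ℝ) (s t : ℝ) : ℝ :=
  a 1 + 2 * a 3 * s + a 4 * t + 3 * a 6 * s ^ 2 + 2 * a 7 * (s * t) + a 8 * t ^ 2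

/-- The partial derivative of `cubic a` in its second variable. -/
def cubicT (a : Fin 10 → ℝ) (s t : ℝ) : ℝ :=
  a 2 + a 4 * s + 2 * a 5 * t + a 7 * s ^ 2 + 2 * a 8 * (s * t) + 3 * a 9 * t ^ 2

/-- A trivariate cubic polynomial, ordered by powers of the last variable. -/
def cubic₃ (a : Fin 10 → ℝ) (b : Fin 6 → ℝ) (r : Fin 4 → ℝ) (s t z : ℝ) : ℝ :=
  cubic a s t + z * quad b s t + z ^ 2 * (r 0 + r 1 * s + r 2 * t + r 3 * z)

theorem cubic_sub (a a' : Fin 10 → ℝ) (s t : ℝ) :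
    cubic (a - a') s t = cubic a s t - cubic a' s t := by
  simp only [cubic, Pi.sub_apply]; ring

theorem cubicS_sub (a a' : Fin 10 → ℝ) (s t : ℝ) :
    cubicS (a - a') s t = cubicS a s t - cubicS a' s t := by
  simp only [cubicS, Pi.sub_apply]; ring

theorem cubicT_sub (a a' : Fin 10 → ℝ) (s t : ℝ) :
    cubicT (a - a') s t = cubicT a s t - cubicT a' s t := by
  simp only [cubicT, Pi.sub_apply]; ring

theorem quad_sub_smul (b b' : Fin 6 → ℝ) (k s t : ℝ) :
    quad (b - k • b') s t = quad b s t - k * quad b' s t := by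
  simp only [quad, Pi.sub_apply, Pi.smul_apply, smul_eq_mul]; ring

/-- Unisolvence of the Hsieh-Clough-Tocher triangle. A `C¹` piecewise cubic on the Clough-Tocher
split vanishes as soon as its values and gradients at the three vertices and its gradients at the
three edge midpoints do. The piece number `i` is `cubic (a i)` in the coordinates
`c + s (Qᵢ - c) + t (Qᵢ₊₁ - c)`, and `l` are the barycentric coordinates of `c`. The hypothesis `hC1`
states continuity of the gradient along the segment from `c` to `Qᵢ₊₁`, in the form that the
gradient annihilates `∑ lⱼ (Qⱼ - c) = 0`. -/
theorem cubic_eq_zero (l : Fin 3 → ℝ) (hl : l 0 + l 1 + l 2 = 1) (a : Fin 3 → Fin 10 → ℝ)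
    (h10 : ∀ i, cubic (a i) 1 0 = 0)
    (hs10 : ∀ i, cubicS (a i) 1 0 = 0) (hs01 : ∀ i, cubicS (a i) 0 1 = 0)
    (ht10 : ∀ i, cubicT (a i) 1 0 = 0) (ht01 : ∀ i, cubicT (a i) 0 1 = 0)
    (hsm : ∀ i, cubicS (a i) (1 / 2) (1 / 2) = 0) (htm : ∀ i, cubicT (a i) (1 / 2) (1 / 2) = 0)
    (hcont : ∀ i, ∀ t, 0 ≤ t → t ≤ 1 → cubic (a i) 0 t = cubic (a (i + 1)) t 0)
    (hC1 : ∀ i, ∀ t, 0 ≤ t → t ≤ 1 → l i * cubicS (a i) 0 t + l (i + 1) * cubicT (a i) 0 t +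
      l (i + 2) * cubicT (a (i + 1)) t 0 = 0) :
    a = 0 := by
  -- The conditions on the outer edge say that piece `i` is `(1 - s - t)² (α + β s + γ t)`, where
  -- `α = a i 0`, `β = a i 1 + 2 α` and `γ = a i 2 + 2 α`.
  have key : ∀ i, a i 3 = a i 0 - 2 * (a i 1 + 2 * a i 0) ∧
      a i 6 = a i 1 + 2 * a i 0 ∧
      a i 5 = a i 0 - 2 * (a i 2 + 2 * a i 0) ∧
      a i 9 = a i 2 + 2 * a i 0 ∧
      a i 4 = 2 * a i 0 - 2 * (a i 1 + 2 * a i 0) - 2 * (a i 2 + 2 * a i 0) ∧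
      a i 7 = 2 * (a i 1 + 2 * a i 0) + (a i 2 + 2 * a i 0) ∧
      a i 8 = (a i 1 + 2 * a i 0) + 2 * (a i 2 + 2 * a i 0) := by
    intro i
    have e1 := h10 i
    have e2 := hs10 i
    have e3 := hs01 i
    have e4 := ht10 i
    have e5 := ht01 i
    have e6 := hsm i
    have e7 := htm i
    simp only [cubic, cubicS, cubicT] at e1 e2 e3 e4 e5 e6 e7
    norm_num at e1 e2 e3 e4 e5 e6 e7
    refine ⟨?_, ?_, ?_, ?_, ?_, ?_, ?_⟩ <;> linarith
  have c0 : ∀ i, a (i + 1) 0 = a i 0 := fun i ↦ by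
    have e := hcont i 0 le_rfl zero_le_one
    simp only [cubic] at e
    norm_num at e
    exact e.symm
  have c1 : ∀ i, a (i + 1) 1 = a i 2 := fun i ↦ by
    have e := hcont i (1 / 2) (by norm_num) (by norm_num)
    obtain ⟨-, -, k5, k9, -⟩ := key i
    obtain ⟨k3, k6, -⟩ := key (i + 1)
    have e0 := c0 i
    simp only [cubic] at e
    norm_num at e
    linarith
  have d0 : ∀ i, l i * a i 1 + l (i + 1) * a i 2 + l (i + 2) * a (i + 1) 2 = 0 := fun i ↦ by
    have e := hC1 i 0 le_rfl zero_le_one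
    simp only [cubicS, cubicT] at e
    norm_num at e
    linarith
  have hl' : ∀ i, l i + l (i + 1) + l (i + 2) = 1 := fun i ↦ by
    rw [sum_cyclic, Fin.sum_univ_three, hl]
  -- This is `γ = -α`. On the segment, `hC1` is `1 - t` times an affine function of `t`; the latter
  -- is zero at `t = 0` by `d0` and at `t = 1 / 2`, so also at `t = 1`, where it is `-2 (α + γ)`.
  have d1 : ∀ i, a i 2 + 3 * a i 0 = 0 := fun i ↦ by
    have e := hC1 i (1 / 2) (by norm_num) (by norm_num)
    obtain ⟨-, -, k5, k9, k4, -, k8⟩ := key i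
    obtain ⟨-, -, -, -, k4', k7', -⟩ := key (i + 1)
    have e0 := c0 i
    have e1 := c1 i
    have e2 := d0 i
    simp only [cubicS, cubicT] at e
    rw [k5, k9, k4, k8, k4', k7', e0, e1] at e
    linear_combination (-2) * e + (1 / 2) * e2 - (a i 2 + 3 * a i 0) * hl' i
  have z0 : ∀ i, a i 0 = 0 := fun i ↦ by
    have e1 : a i 1 = a (i + 2) 2 := by
      rw [← c1 (i + 2), add_assoc, show (2 + 1 : Fin 3) = 0 from rfl, add_zero]
    have e0 : a (i + 2) 0 = a i 0 := by
      rw [show i + 2 = i + 1 + 1 by rw [add_assoc]; rfl, c0, c0]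
    have f0 := d1 i
    have f1 := d1 (i + 1)
    have f2 := d1 (i + 2)
    have e := d0 i
    have e0' := c0 i
    rw [e1] at e
    rw [e0] at f2
    rw [e0'] at f1
    linear_combination (-1 / 3) * e + (1 / 3) * l i * f2 + (1 / 3) * l (i + 1) * f0 +
      (1 / 3) * l (i + 2) * f1 - a i 0 * hl' i
  have z2 : ∀ i, a i 2 = 0 := fun i ↦ by linarith [d1 i, z0 i]
  have z1 : ∀ i, a i 1 = 0 := fun i ↦ by
    rw [show i = i + 2 + 1 by rw [add_assoc, show (2 + 1 : Fin 3) = 0 from rfl, add_zero],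
      c1, z2]
  funext i j
  obtain ⟨k3, k6, k5, k9, k4, k7, k8⟩ := key i
  simp only [z0, z1, z2] at k3 k6 k5 k9 k4 k7 k8
  fin_cases j
  · exact z0 i
  · exact z1 i
  · exact z2 i
  · exact k3.trans (by norm_num)
  · exact k4.trans (by norm_num)
  · exact k5.trans (by norm_num)
  · exact k6.trans (by norm_num)
  · exact k7.trans (by norm_num)
  · exact k8.trans (by norm_num)
  · exact k9.trans (by norm_num)

/-- A `C¹` piecewise quadratic on the Clough-Tocher split of a triangle vanishes as soon as its
values at the vertices and the edge midpoints do: such a function is a single quadratic polynomial.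
The notation is that of `cubic_eq_zero`; `hC1` and `hC1'` are the coefficients in `t` of the `C¹`
condition along the segment from `c` to `Qᵢ₊₁`. -/
theorem quad_eq_zero (l : Fin 3 → ℝ) (hl : l 0 + l 1 + l 2 = 1) (b : Fin 3 → Fin 6 → ℝ)
    (h10 : ∀ i, quad (b i) 1 0 = 0) (h01 : ∀ i, quad (b i) 0 1 = 0)
    (hm : ∀ i, quad (b i) (1 / 2) (1 / 2) = 0)
    (hcont : ∀ i, ∀ t, 0 ≤ t → t ≤ 1 → quad (b i) 0 t = quad (b (i + 1)) t 0)
    (hC1 : ∀ i, l i * b i 1 + l (i + 1) * b i 2 + l (i + 2) * b (i + 1) 2 = 0)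
    (hC1' : ∀ i, l i * b i 4 + l (i + 1) * (2 * b i 5) + l (i + 2) * b (i + 1) 4 = 0) :
    b = 0 := by
  have hl' : ∀ i, l i + l (i + 1) + l (i + 2) = 1 := fun i ↦ by
    rw [sum_cyclic, Fin.sum_univ_three, hl]
  have key : ∀ i, b i 1 = -b i 0 - b i 3 ∧ b i 2 = -b i 0 - b i 5 ∧ b i 4 = b i 3 + b i 5 := by
    intro i
    have e1 := h10 i
    have e2 := h01 i
    have e3 := hm i
    simp only [quad] at e1 e2 e3
    norm_num at e1 e2 e3
    refine ⟨?_, ?_, ?_⟩ <;> linarith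
  have c0 : ∀ i, b (i + 1) 0 = b i 0 := fun i ↦ by
    have e := hcont i 0 le_rfl zero_le_one
    simp only [quad] at e
    norm_num at e
    exact e.symm
  have c3 : ∀ i, b (i + 1) 3 = b i 5 := fun i ↦ by
    have e := hcont i (1 / 2) (by norm_num) (by norm_num)
    obtain ⟨-, k2, -⟩ := key i
    obtain ⟨k1, -⟩ := key (i + 1)
    have e0 := c0 i
    simp only [quad] at e
    norm_num at e
    linarith
  -- The pure second order coefficients all equal the value `b i 0` at `c`; the `C¹` condition at `c`
  -- then gives `2 * b i 0 = 0`.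
  have d5 : ∀ i, b i 5 = b i 0 := fun i ↦ by
    have e := hC1 i
    have e' := hC1' i
    obtain ⟨k1, k2, k4⟩ := key i
    obtain ⟨-, k2', k4'⟩ := key (i + 1)
    rw [k1, k2, k2', c0 i] at e
    rw [k4, k4', c3 i] at e'
    linear_combination e + e' - (b i 5 - b i 0) * hl' i
  have d3 : ∀ i, b i 3 = b i 0 := fun i ↦ by
    have h : i = i + 2 + 1 := by
      rw [add_assoc, show (2 + 1 : Fin 3) = 0 from rfl, add_zero]
    rw [h, c3, d5, c0]
  have z0 : ∀ i, b i 0 = 0 := fun i ↦ by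
    have e := hC1 i
    rw [(key i).1, (key i).2.1, (key (i + 1)).2.1, d5, d5, d3, c0] at e
    linear_combination (-1 / 2) * e - b i 0 * hl' i
  funext i j
  obtain ⟨k1, k2, k4⟩ := key i
  simp only [d3, d5, z0] at k1 k2 k4
  fin_cases j
  · exact z0 i
  · exact k1.trans (by norm_num)
  · exact k2.trans (by norm_num)
  · exact (d3 i).trans (z0 i)
  · exact k4.trans (by norm_num)
  · exact (d5 i).trans (z0 i)

/-! ### Polynomials in affine coordinates -/

/-- An affine substitution does not raise the total degree. -/
theorem exists_eval_affine (p : MvPolynomial (Fin 3) ℝ) {n : ℕ} (hp : p.totalDegree ≤ n)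
    (c u v d : E3) :
    ∃ q : MvPolynomial (Fin 3) ℝ, q.totalDegree ≤ n ∧ ∀ s t z : ℝ,
      MvPolynomial.eval (fun i ↦ (c + s • u + t • v + z • d) i) p =
        MvPolynomial.eval ![s, t, z] q := by
  classical
  let L : Fin 3 → MvPolynomial (Fin 3) ℝ := fun i ↦
    MvPolynomial.C (c i) + MvPolynomial.C (u i) * MvPolynomial.X 0 +
      MvPolynomial.C (v i) * MvPolynomial.X 1 + MvPolynomial.C (d i) * MvPolynomial.X 2
  have hX : ∀ (x : ℝ) (j : Fin 3),
      (MvPolynomial.C x * MvPolynomial.X j : MvPolynomial (Fin 3) ℝ).totalDegree ≤ 1 := by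
    intro x j
    refine (MvPolynomial.totalDegree_mul _ _).trans ?_
    simp
  have hL : ∀ i, (L i).totalDegree ≤ 1 := by
    intro i
    refine (MvPolynomial.totalDegree_add _ _).trans (max_le ?_ (hX _ _))
    refine (MvPolynomial.totalDegree_add _ _).trans (max_le ?_ (hX _ _))
    refine (MvPolynomial.totalDegree_add _ _).trans (max_le ?_ (hX _ _))
    simp
  refine ⟨MvPolynomial.bind₁ L p, ?_, ?_⟩
  · rw [MvPolynomial.bind₁, MvPolynomial.aeval_def, MvPolynomial.eval₂_eq]
    refine MvPolynomial.totalDegree_finsetSum_le fun m hm ↦ ?_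
    refine (MvPolynomial.totalDegree_mul _ _).trans ?_
    refine (add_le_add (MvPolynomial.totalDegree_C _).le
      (MvPolynomial.totalDegree_finsetProd _ _)).trans ?_
    rw [zero_add]
    refine le_trans (Finset.sum_le_sum fun i _ ↦ ?_)
      ((MvPolynomial.le_totalDegree hm).trans hp)
    refine (MvPolynomial.totalDegree_pow _ _).trans ?_
    exact (Nat.mul_le_mul_left _ (hL i)).trans (mul_one _).le
  · intro s t z
    unfold MvPolynomial.eval
    rw [MvPolynomial.eval₂Hom_bind₁]
    refine congrArg (fun w ↦ MvPolynomial.eval w p) (funext fun i ↦ ?_)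
    simp [L]
    ring

theorem eval_eq_sum_range (q : MvPolynomial (Fin 3) ℝ) (hq : q.totalDegree ≤ 3) :
    ∃ α : ℕ → ℕ → ℕ → ℝ, (∀ i j k, 3 < i + j + k → α i j k = 0) ∧ ∀ s t z : ℝ,
      MvPolynomial.eval ![s, t, z] q =
        ∑ i ∈ Finset.range 4, ∑ j ∈ Finset.range 4, ∑ k ∈ Finset.range 4,
          α i j k * (s ^ i * t ^ j * z ^ k) := by
  classical
  let g : ℕ × ℕ × ℕ → (Fin 3 →₀ ℕ) := fun m ↦ Finsupp.equivFunOnFinite.symm ![m.1, m.2.1, m.2.2]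
  have hg : Function.Injective g := by
    rintro ⟨i, j, k⟩ ⟨i', j', k'⟩ h
    have h := Finsupp.equivFunOnFinite.symm.injective h
    have h0 := congrFun h 0
    have h1 := congrFun h 1
    have h2 := congrFun h 2
    simp at h0 h1 h2
    simp [h0, h1, h2]
  refine ⟨fun i j k ↦ q.coeff (g (i, j, k)), fun i j k h ↦ ?_, fun s t z ↦ ?_⟩
  · apply MvPolynomial.coeff_eq_zero_of_totalDegree_lt
    refine hq.trans_lt (h.trans_le (le_of_eq ?_))
    rw [Finset.sum_subset (Finset.subset_univ _) (by simp), Fin.sum_univ_three]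
    simp [g]
  · rw [MvPolynomial.eval_eq']
    have hsub : q.support ⊆ ((Finset.range 4 ×ˢ Finset.range 4 ×ˢ Finset.range 4).image g) := by
      intro m hm
      have h := (MvPolynomial.le_totalDegree hm).trans hq
      rw [Finsupp.sum_fintype _ _ (by simp), Fin.sum_univ_three] at h
      refine Finset.mem_image.2 ⟨(m 0, m 1, m 2), ?_, ?_⟩
      · simp only [Finset.mem_product, Finset.mem_range]; omega
      · ext i; fin_cases i <;> simp [g]
    rw [Finset.sum_subset hsub (fun m _ hm ↦ by
      rw [MvPolynomial.notMem_support_iff.1 hm, zero_mul]), Finset.sum_image hg.injOn,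
      Finset.sum_product]
    refine Finset.sum_congr rfl fun i _ ↦ ?_
    rw [Finset.sum_product]
    refine Finset.sum_congr rfl fun j _ ↦ Finset.sum_congr rfl fun k _ ↦ ?_
    simp [g, Fin.prod_univ_three]

theorem exists_eval_eq_cubic₃ (q : MvPolynomial (Fin 3) ℝ) (hq : q.totalDegree ≤ 3) :
    ∃ a b r, ∀ s t z : ℝ, MvPolynomial.eval ![s, t, z] q = cubic₃ a b r s t z := by
  obtain ⟨α, h0, h⟩ := eval_eq_sum_range q hq
  refine ⟨![α 0 0 0, α 1 0 0, α 0 1 0, α 2 0 0, α 1 1 0, α 0 2 0, α 3 0 0, α 2 1 0, α 1 2 0,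
    α 0 3 0], ![α 0 0 1, α 1 0 1, α 0 1 1, α 2 0 1, α 1 1 1, α 0 2 1],
    ![α 0 0 2, α 1 0 2, α 0 1 2, α 0 0 3], fun s t z ↦ ?_⟩
  rw [h]
  simp only [Finset.sum_range_succ, Finset.sum_range_zero]
  simp [h0, cubic₃, cubic, quad]
  ring

theorem hasDerivAt_cubic (c₀ c₁ c₂ c₃ x : ℝ) :
    HasDerivAt (fun y ↦ c₀ + c₁ * y + c₂ * y ^ 2 + c₃ * y ^ 3)
      (c₁ + 2 * c₂ * x + 3 * c₃ * x ^ 2) x := by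
  have h := ((((hasDerivAt_id x).const_mul c₁).const_add c₀).add
    ((hasDerivAt_pow 2 x).const_mul c₂)).add ((hasDerivAt_pow 3 x).const_mul c₃)
  refine (h.congr_deriv ?_)
  norm_num
  ring

/-! ### Gluing along closed sets, and vectors in three-space -/

theorem eqOn_piecewise_right {E G : Type*} {s t : Set E} [DecidablePred (· ∈ s)] {f g : E → G}
    (h : ∀ x ∈ s ∩ t, f x = g x) : Set.EqOn (s.piecewise f g) g t := by
  intro x hx
  by_cases hxs : x ∈ s
  · rw [Set.piecewise_eq_of_mem _ _ _ hxs, h x ⟨hxs, hx⟩]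
  · rw [Set.piecewise_eq_of_notMem _ _ _ hxs]

/-- Two `C¹` functions on closed sets glue to a `C¹` function on the union if their values and their
derivatives agree on the intersection. -/
theorem contDiffOn_one_piecewise_union {E G : Type*} [NormedAddCommGroup E] [NormedSpace ℝ E]
    [NormedAddCommGroup G] [NormedSpace ℝ G] {s t : Set E} [DecidablePred (· ∈ s)]
    (hs : IsClosed s) (ht : IsClosed t) (hs' : UniqueDiffOn ℝ s) (ht' : UniqueDiffOn ℝ t)
    {f g : E → G} (hf : ContDiffOn ℝ 1 f s) (hg : ContDiffOn ℝ 1 g t)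
    (hfg : ∀ x ∈ s ∩ t, f x = g x)
    (hd : ∀ x ∈ s ∩ t, fderivWithin ℝ f s x = fderivWithin ℝ g t x) :
    ContDiffOn ℝ 1 (s.piecewise f g) (s ∪ t) := by
  set D : E → E →L[ℝ] G := s.piecewise (fderivWithin ℝ f s) (fderivWithin ℝ g t) with hD
  have hDs : Set.EqOn D (fderivWithin ℝ f s) s := Set.piecewise_eqOn _ _ _
  have hDt : Set.EqOn D (fderivWithin ℝ g t) t := eqOn_piecewise_right hd
  have hDc : ContinuousOn D (s ∪ t) :=
    ((hf.continuousOn_fderivWithin hs' le_rfl).congr hDs).union_of_isClosed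
      ((hg.continuousOn_fderivWithin ht' le_rfl).congr hDt) hs ht
  have h1 : ∀ x, HasFDerivWithinAt (s.piecewise f g) (D x) s x := fun x ↦ by
    by_cases hx : x ∈ s
    · rw [hDs hx]
      exact ((hf.differentiableOn_one x hx).hasFDerivWithinAt).congr
        (Set.piecewise_eqOn _ _ _) (Set.piecewise_eqOn _ _ _ hx)
    · exact HasFDerivWithinAt.of_notMem_closure (by rwa [hs.closure_eq])
  have h2 : ∀ x, HasFDerivWithinAt (s.piecewise f g) (D x) t x := fun x ↦ by
    by_cases hx : x ∈ t
    · rw [hDt hx]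
      exact ((hg.differentiableOn_one x hx).hasFDerivWithinAt).congr
        (eqOn_piecewise_right hfg) (eqOn_piecewise_right hfg hx)
    · exact HasFDerivWithinAt.of_notMem_closure (by rwa [ht.closure_eq])
  rw [← zero_add (1 : WithTop ℕ∞), contDiffOn_succ_iff_hasFDerivWithinAt (by simp)]
  intro x hx
  rw [Set.insert_eq_of_mem hx]
  exact ⟨s ∪ t, self_mem_nhdsWithin, by simp, D, fun y _ ↦ (h1 y).union (h2 y),
    contDiffOn_zero.2 hDc⟩

theorem uniqueDiffOn_closedInterior (K : Tetrahedron) : UniqueDiffOn ℝ K.closedInterior := by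
  have hc : Convex ℝ K.closedInterior := by
    rw [← Affine.Simplex.convexHull_eq_closedInterior]; exact convex_convexHull _ _
  refine uniqueDiffOn_convex hc ?_
  rw [← Affine.Simplex.convexHull_eq_closedInterior, interior_convexHull_nonempty_iff_affineSpan_eq_top]
  exact K.span_eq_top (by simp)

theorem eq_zero_of_cross_of_inner {g v : E3} (hv : v ≠ 0) (h1 : cross g v = 0)
    (h2 : inner ℝ g v = 0) : g = 0 := by
  have e : g.ofLp ⨯₃ v.ofLp = 0 := by
    simpa [cross] using congrArg WithLp.ofLp h1
  have e2 := cross_dot_cross g.ofLp v.ofLp g.ofLp v.ofLp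
  have h3 : g.ofLp ⬝ᵥ v.ofLp = 0 := by
    rw [← h2, EuclideanSpace.inner_eq_star_dotProduct, dotProduct_comm]; simp
  have h4 : v.ofLp ⬝ᵥ v.ofLp ≠ 0 := by
    simpa [dotProduct_self_eq_zero] using hv
  rw [e, h3] at e2
  simp only [zero_dotProduct, zero_mul, sub_zero] at e2
  have h5 : g.ofLp ⬝ᵥ g.ofLp = 0 := by
    rcases mul_eq_zero.1 e2.symm with h | h
    · exact h
    · exact absurd h h4
  simpa [dotProduct_self_eq_zero] using h5

/-! ### Cubics on a tetrahedron -/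

/-- The closed unit simplex in `ℝ³`. -/
def unitSimplex : Set (ℝ × ℝ × ℝ) :=
  {p | 0 ≤ p.1 ∧ 0 ≤ p.2.1 ∧ 0 ≤ p.2.2 ∧ p.1 + p.2.1 + p.2.2 ≤ 1}

theorem uniqueDiffOn_unitSimplex : UniqueDiffOn ℝ unitSimplex := by
  refine uniqueDiffOn_convex ?_ ⟨(1 / 4, 1 / 4, 1 / 4), ?_⟩
  · rintro ⟨s, t, z⟩ ⟨h1, h2, h3, h4⟩ ⟨s', t', z'⟩ ⟨h1', h2', h3', h4'⟩ a b ha hb hab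
    simp only at h1 h2 h3 h4 h1' h2' h3' h4'
    refine ⟨?_, ?_, ?_, ?_⟩ <;> simp only [Prod.smul_mk, Prod.mk_add_mk, smul_eq_mul]
    · positivity
    · positivity
    · positivity
    · nlinarith
  · have ho : IsOpen {p : ℝ × ℝ × ℝ | 0 < p.1 ∧ 0 < p.2.1 ∧ 0 < p.2.2 ∧
        p.1 + p.2.1 + p.2.2 < 1} := by
      refine IsOpen.and ?_ (IsOpen.and ?_ (IsOpen.and ?_ ?_)) <;>
        exact isOpen_lt (by fun_prop) (by fun_prop)
    refine mem_interior.2 ⟨_, ?_, ho, ?_⟩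
    · exact fun p hp ↦ ⟨hp.1.le, hp.2.1.le, hp.2.2.1.le, hp.2.2.2.le⟩
    · norm_num

theorem mem_convexHull_of_unitSimplex {P Q e c : E3} {s t z : ℝ} (h : (s, t, z) ∈ unitSimplex) :
    c + s • (P - c) + t • (Q - c) + z • (e - c) ∈ convexHull ℝ {P, Q, e, c} := by
  obtain ⟨h1, h2, h3, h4⟩ := h
  have hc := convex_convexHull ℝ ({P, Q, e, c} : Set E3)
  have := hc.sum_mem (t := Finset.univ) (w := ![s, t, z, 1 - s - t - z]) (z := ![P, Q, e, c])
    (by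
      intro i _
      fin_cases i
      · exact h1
      · exact h2
      · exact h3
      · simp at h4 ⊢; linarith)
    (by simp [Fin.sum_univ_four])
    (by
      intro i _
      apply subset_convexHull
      fin_cases i <;> simp)
  convert this using 1
  simp [Fin.sum_univ_four]
  module

/-- A function that is cubic on the tetrahedron `conv {P, Q, e, c}`, written in the coordinates
`c + s (P - c) + t (Q - c) + z (e - c)`, together with its derivatives in the three coordinate
directions. The derivatives are those of `f` as a function on the larger set `K`. They are determined
by the values on the tetrahedron since this is the image of a set of unique differentiability. -/
theorem exists_cubic₃_of_isPolyOn {K : Set E3} {f : E3 → ℝ} (hf : DifferentiableOn ℝ f K)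
    {P Q e c : E3} (hK : convexHull ℝ {P, Q, e, c} ⊆ K)
    (hp : IsPolyOn 3 f (convexHull ℝ {P, Q, e, c})) :
    ∃ (a : Fin 10 → ℝ) (b : Fin 6 → ℝ) (r : Fin 4 → ℝ), ∀ s t z : ℝ, (s, t, z) ∈ unitSimplex →
      ∀ x, x = c + s • (P - c) + t • (Q - c) + z • (e - c) →
      f x = cubic₃ a b r s t z ∧
      fderivWithin ℝ f K x (P - c) =
        cubicS a s t + z * (b 1 + 2 * b 3 * s + b 4 * t) + z ^ 2 * r 1 ∧
      fderivWithin ℝ f K x (Q - c) =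
        cubicT a s t + z * (b 2 + b 4 * s + 2 * b 5 * t) + z ^ 2 * r 2 ∧
      fderivWithin ℝ f K x (e - c) =
        quad b s t + 2 * z * (r 0 + r 1 * s + r 2 * t) + 3 * z ^ 2 * r 3 := by
  obtain ⟨p, hpd, hpf⟩ := hp
  obtain ⟨q, hq, hqp⟩ := exists_eval_affine p hpd c (P - c) (Q - c) (e - c)
  obtain ⟨a, b, r, habr⟩ := exists_eval_eq_cubic₃ q hq
  refine ⟨a, b, r, fun s t z hm x hx ↦ ?_⟩
  let φ : ℝ × ℝ × ℝ → E3 := fun p ↦ c + p.1 • (P - c) + p.2.1 • (Q - c) + p.2.2 • (e - c)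
  let G : ℝ × ℝ × ℝ → ℝ := fun p ↦ cubic₃ a b r p.1 p.2.1 p.2.2
  have hφ : ∀ p ∈ unitSimplex, φ p ∈ convexHull ℝ {P, Q, e, c} := fun p hp ↦
    mem_convexHull_of_unitSimplex (s := p.1) (t := p.2.1) (z := p.2.2) hp
  have hG : ∀ p ∈ unitSimplex, f (φ p) = G p := fun p hp ↦ by
    rw [hpf _ (hφ p hp), hqp, habr]
  have hGd : HasFDerivAt G (fderiv ℝ G (s, t, z)) (s, t, z) := by
    apply DifferentiableAt.hasFDerivAt
    simp only [G, cubic₃, cubic, quad]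
    fun_prop
  let φ' : ℝ × ℝ × ℝ →L[ℝ] E3 :=
    (ContinuousLinearMap.fst ℝ ℝ (ℝ × ℝ)).smulRight (P - c) +
    ((ContinuousLinearMap.fst ℝ ℝ ℝ).comp (ContinuousLinearMap.snd ℝ ℝ (ℝ × ℝ))).smulRight (Q - c) +
    ((ContinuousLinearMap.snd ℝ ℝ ℝ).comp (ContinuousLinearMap.snd ℝ ℝ (ℝ × ℝ))).smulRight (e - c)
  have hφd : HasFDerivAt φ φ' (s, t, z) := by
    have : φ = fun p ↦ c + φ' p := by
      funext p; simp only [φ, φ']; simp [add_assoc]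
    rw [this]
    exact φ'.hasFDerivAt.const_add c
  have hxφ : φ (s, t, z) = x := hx.symm
  have hfd : HasFDerivWithinAt f (fderivWithin ℝ f K x) K (φ (s, t, z)) := by
    rw [hxφ]
    exact (hf x (hK (hxφ ▸ hφ _ hm))).hasFDerivWithinAt
  have hcomp := hfd.comp (s, t, z) (hφd.hasFDerivWithinAt (s := unitSimplex))
    (fun p hp ↦ hK (hφ p hp))
  have hcomp' := (hGd.hasFDerivWithinAt (s := unitSimplex)).congr hG (hG _ hm)
  have key := (uniqueDiffOn_unitSimplex _ hm).eq hcomp hcomp'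
  have hval : ∀ v, fderivWithin ℝ f K x (φ' v) = fderiv ℝ G (s, t, z) v := fun v ↦
    DFunLike.congr_fun key v
  have e1 := hval (1, 0, 0)
  have e2 := hval (0, 1, 0)
  have e3 := hval (0, 0, 1)
  rw [show φ' (1, 0, 0) = P - c by simp [φ']] at e1
  rw [show φ' (0, 1, 0) = Q - c by simp [φ']] at e2
  rw [show φ' (0, 0, 1) = e - c by simp [φ']] at e3
  refine ⟨?_, ?_, ?_, ?_⟩
  · rw [← hxφ, hG _ hm]
  · have h := (hGd.comp_hasDerivAt s (f := fun y ↦ (y, t, z))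
      ((hasDerivAt_id s).prodMk (hasDerivAt_const s (t, z))))
    have h' := hasDerivAt_cubic (cubic₃ a b r 0 t z)
      (a 1 + a 4 * t + a 8 * t ^ 2 + z * (b 1 + b 4 * t) + z ^ 2 * r 1)
      (a 3 + a 7 * t + z * b 3) (a 6) s
    rw [e1]
    refine (h.unique (h'.congr_of_eventuallyEq (Filter.Eventually.of_forall fun y ↦ ?_))).trans ?_
    · simp only [G, Function.comp_apply, cubic₃, cubic, quad]; ring
    · simp only [cubicS]; ring
  · have h := (hGd.comp_hasDerivAt t (f := fun y ↦ (s, y, z))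
      ((hasDerivAt_const t s).prodMk ((hasDerivAt_id t).prodMk (hasDerivAt_const t z))))
    have h' := hasDerivAt_cubic (cubic₃ a b r s 0 z)
      (a 2 + a 4 * s + a 7 * s ^ 2 + z * (b 2 + b 4 * s) + z ^ 2 * r 2)
      (a 5 + a 8 * s + z * b 5) (a 9) t
    rw [e2]
    refine (h.unique (h'.congr_of_eventuallyEq (Filter.Eventually.of_forall fun y ↦ ?_))).trans ?_
    · simp only [G, Function.comp_apply, cubic₃, cubic, quad]; ring
    · simp only [cubicT]; ring
  · have h := (hGd.comp_hasDerivAt z (f := fun y ↦ (s, t, y))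
      ((hasDerivAt_const z s).prodMk ((hasDerivAt_const z t).prodMk (hasDerivAt_id z))))
    have h' := hasDerivAt_cubic (cubic a s t) (quad b s t) (r 0 + r 1 * s + r 2 * t) (r 3) z
    rw [e3]
    refine (h.unique (h'.congr_of_eventuallyEq (Filter.Eventually.of_forall fun y ↦ ?_))).trans ?_
    · simp only [G, Function.comp_apply, cubic₃]; ring
    · ring

/-! ### Worsey-Farin functions near a face -/

theorem IsFaceOpposite.exists_vertex {F : Triangle} {K : Tetrahedron} {m : Fin 4}
    (h : IsFaceOpposite F K m) (l : Fin 3) : ∃ j, j ≠ m ∧ K.points j = F.points l := by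
  have h' : F.points l ∈ Set.range (K.faceOpposite m).points := h ▸ Set.mem_range_self l
  rw [Affine.Simplex.range_faceOpposite_points] at h'
  obtain ⟨j, hj, e⟩ := h'
  exact ⟨j, hj, e⟩

theorem interior_eq_of_range_eq {F T : Triangle} (h : Set.range F.points = Set.range T.points) :
    F.interior = T.interior := by
  have h1 : ∀ l, ∃ k, T.points k = F.points l := fun l ↦ by
    rw [← Set.mem_range, ← h]; exact Set.mem_range_self l
  choose e he using h1
  have hinj : Function.Injective e := fun l l' hl ↦
    F.independent.injective (by rw [← he, ← he, hl])
  let E : Fin 3 ≃ Fin 3 := Equiv.ofBijective e (Finite.injective_iff_bijective.1 hinj)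
  have hFT : F = T.reindex E.symm := by
    ext1 l
    exact (he l).symm
  rw [hFT, Affine.Simplex.interior_reindex]

theorem Centers.cF_mem_interior {F : Triangle} {K : Tetrahedron} {m : Fin 4} (c : Centers K)
    (h : IsFaceOpposite F K m) : c.cF m ∈ F.interior :=
  (interior_eq_of_range_eq (T := K.faceOpposite m) h).symm ▸ c.cF_mem m

theorem IsFaceOpposite.mem_partition {F : Triangle} {K : Tetrahedron} {m : Fin 4} (c : Centers K)
    (h : IsFaceOpposite F K m) {i j : Fin 3} (hij : i ≠ j) :
    convexHull ℝ {F.points i, F.points j, c.cK, c.cF m} ∈ partition c := by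
  obtain ⟨k, hk, ek⟩ := h.exists_vertex i
  obtain ⟨l, hl, el⟩ := h.exists_vertex j
  have hkl : k ≠ l := fun e ↦ hij (F.independent.injective (by rw [← ek, ← el, e]))
  rcases lt_or_gt_of_ne hkl with hlt | hlt
  · exact ⟨k, l, m, hlt, hk.symm, hl.symm, by rw [ek, el]⟩
  · exact ⟨l, k, m, hlt, hl.symm, hk.symm, by rw [ek, el, Set.insert_comm]⟩

theorem IsFaceOpposite.convexHull_subset {F : Triangle} {K : Tetrahedron} {m : Fin 4}
    (c : Centers K) (h : IsFaceOpposite F K m) (i j : Fin 3) :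
    convexHull ℝ {F.points i, F.points j, c.cK, c.cF m} ⊆ K.closedInterior := by
  obtain ⟨k, hk, ek⟩ := h.exists_vertex i
  obtain ⟨l, hl, el⟩ := h.exists_vertex j
  refine convexHull_min ?_ ?_
  · rintro x (rfl | rfl | rfl | rfl)
    · exact ek ▸ K.point_mem_closedInterior k
    · exact el ▸ K.point_mem_closedInterior l
    · exact K.interior_subset_closedInterior c.cK_mem
    · exact K.closedInterior_faceOpposite_subset_closedInterior m
        ((K.faceOpposite m).interior_subset_closedInterior (c.cF_mem m))
  · rw [← Affine.Simplex.convexHull_eq_closedInterior]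
    exact convex_convexHull _ _

/-- The restriction to the face of a function in the Worsey-Farin space, and of its derivative in
the direction `c_K - c`, on the three triangles of the Clough-Tocher split. The first is piecewise
cubic, the second piecewise quadratic. The last two conclusions say that the latter is `C¹`: on the
interior triangle `conv {c, c_K, Qᵢ₊₁}`, which contains the direction `c_K - c`, the derivatives of `f`
in the transversal directions are continuous, and the terms linear in `z` of this identity are the
`C¹` conditions for the derivative in the direction `c_K - c`. -/
theorem exists_face_coeffs {F : Triangle} {K : Tetrahedron} {m : Fin 4} (cen : Centers K)
    (h : IsFaceOpposite F K m) {f : E3 → ℝ} (hf : IsWF K cen f) {c : E3} (hc : cen.cF m = c)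
    {l : Fin 3 → ℝ} (hl : ∀ i, l i • (F.points i - c) + l (i + 1) • (F.points (i + 1) - c) +
      l (i + 2) • (F.points (i + 2) - c) = 0) :
    ∃ (a : Fin 3 → Fin 10 → ℝ) (b : Fin 3 → Fin 6 → ℝ),
      (∀ i, ∀ s t : ℝ, 0 ≤ s → 0 ≤ t → s + t ≤ 1 →
        ∀ x, x = c + s • (F.points i - c) + t • (F.points (i + 1) - c) →
        f x = cubic (a i) s t ∧
        fderivWithin ℝ f K.closedInterior x (F.points i - c) = cubicS (a i) s t ∧
        fderivWithin ℝ f K.closedInterior x (F.points (i + 1) - c) = cubicT (a i) s t ∧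
        fderivWithin ℝ f K.closedInterior x (cen.cK - c) = quad (b i) s t) ∧
      (∀ i, l i * b i 1 + l (i + 1) * b i 2 + l (i + 2) * b (i + 1) 2 = 0) ∧
      (∀ i, l i * b i 4 + l (i + 1) * (2 * b i 5) + l (i + 2) * b (i + 1) 4 = 0) := by
  subst hc
  have hne : ∀ i : Fin 3, i ≠ i + 1 := by decide
  choose a b r H using fun i : Fin 3 ↦ exists_cubic₃_of_isPolyOn hf.1.differentiableOn_one
    (h.convexHull_subset cen i (i + 1)) (hf.2 _ (h.mem_partition cen (hne i)))
  refine ⟨a, b, fun i s t hs ht hst x hx ↦ ?_, ?_⟩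
  · have := H i s t 0 ⟨hs, ht, le_rfl, by simpa using hst⟩ x (by rw [hx, zero_smul, add_zero])
    simpa [cubic₃] using this
  -- The `C¹` condition on the interior triangle `conv {c, c_K, Qᵢ₊₁}`, at the point
  -- `c + t (Qᵢ₊₁ - c) + z (c_K - c)`.
  have hE : ∀ i : Fin 3, ∀ t z : ℝ, 0 ≤ t → 0 ≤ z → t + z ≤ 1 →
      l i * (cubicS (a i) 0 t + z * (b i 1 + b i 4 * t) + z ^ 2 * r i 1) +
      l (i + 1) * (cubicT (a i) 0 t + z * (b i 2 + 2 * b i 5 * t) + z ^ 2 * r i 2) +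
      l (i + 2) * (cubicT (a (i + 1)) t 0 + z * (b (i + 1) 2 + b (i + 1) 4 * t) +
        z ^ 2 * r (i + 1) 2) = 0 := by
    intro i t z ht hz htz
    have hi : i + 1 + 1 = i + 2 := by rw [add_assoc]; rfl
    obtain ⟨-, e1, e2, -⟩ := H i 0 t z ⟨le_rfl, ht, hz, by simpa using htz⟩ _ rfl
    obtain ⟨-, -, e3, -⟩ := H (i + 1) t 0 z ⟨ht, le_rfl, hz, by simpa using htz⟩ _ rfl
    rw [hi] at e3
    simp only [zero_smul, add_zero, mul_zero] at e1 e2 e3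
    rw [← e1, ← e2, ← e3, ← smul_eq_mul, ← smul_eq_mul, ← smul_eq_mul, ← map_smul, ← map_smul,
      ← map_smul, ← map_add, ← map_add, hl i, map_zero]
  -- The coefficients of `z` and of `t z`, from finite differences.
  refine ⟨fun i ↦ ?_, fun i ↦ ?_⟩
  · have e0 := hE i 0 0 (by norm_num) (by norm_num) (by norm_num)
    have e1 := hE i 0 (1 / 2) (by norm_num) (by norm_num) (by norm_num)
    have e2 := hE i 0 1 (by norm_num) (by norm_num) (by norm_num)
    linear_combination -3 * e0 + 4 * e1 - e2
  · have e0 := hE i 0 0 (by norm_num) (by norm_num) (by norm_num)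
    have e1 := hE i 0 (1 / 2) (by norm_num) (by norm_num) (by norm_num)
    have f0 := hE i (1 / 2) 0 (by norm_num) (by norm_num) (by norm_num)
    have f1 := hE i (1 / 2) (1 / 2) (by norm_num) (by norm_num) (by norm_num)
    linear_combination 4 * e0 - 4 * e1 - 4 * f0 + 4 * f1

/-! ### Comparison on the common face -/

theorem grad_sub_inner {K₁ K₂ : Tetrahedron} {f₁ f₂ : E3 → ℝ} (x v : E3) :
    inner ℝ (grad K₁ f₁ x - grad K₂ f₂ x) v =
      fderivWithin ℝ f₁ K₁.closedInterior x v - fderivWithin ℝ f₂ K₂.closedInterior x v := by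
  rw [inner_sub_left]
  simp [grad, gradientWithin]

/-- The edge midpoint condition for either orientation of the edge and without normalization of the
tangent vector. -/
theorem FaceDofsAgree.cross_midpoint {F : Triangle} {K₁ K₂ : Tetrahedron} {f₁ f₂ : E3 → ℝ}
    (h : FaceDofsAgree F K₁ K₂ f₁ f₂) {j k : Fin 3} (hjk : j ≠ k) :
    cross (grad K₁ f₁ (midpoint ℝ (F.points j) (F.points k)) -
      grad K₂ f₂ (midpoint ℝ (F.points j) (F.points k))) (F.points k - F.points j) = 0 := by
  have key : ∀ j k, j < k → ∀ κ : ℝ, cross (grad K₁ f₁ (midpoint ℝ (F.points j) (F.points k)) -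
      grad K₂ f₂ (midpoint ℝ (F.points j) (F.points k))) (κ • (F.points k - F.points j)) = 0 := by
    intro j k hjk κ
    have hn : ‖F.points k - F.points j‖ ≠ 0 :=
      norm_ne_zero_iff.2 (sub_ne_zero.2 (F.independent.injective.ne hjk.ne'))
    have e := congrArg WithLp.ofLp (h.2.2 j k hjk)
    simp only [cross, unitTangent] at e
    generalize F.points k - F.points j = v at e hn ⊢
    simp only [WithLp.ofLp_smul, map_smul] at e
    have e' := smul_right_injective _ (inv_ne_zero hn) e
    simp only [cross, WithLp.ofLp_smul, map_smul, WithLp.ofLp_sub, map_sub,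
      LinearMap.sub_apply] at e' ⊢
    rw [e']
    simp
  rcases lt_or_gt_of_ne hjk with hlt | hlt
  · simpa using key j k hlt 1
  · have := key k j hlt (-1)
    rwa [neg_one_smul, neg_sub, midpoint_comm] at this

/-- The three triangles of the Clough-Tocher split with centre `c` cover the triangle. -/
theorem exists_subtriangle {F : Triangle} {c : E3} {l : Fin 3 → ℝ} (hpos : ∀ i, 0 < l i)
    (hl1 : l 0 + l 1 + l 2 = 1)
    (hl : ∀ i, l i • (F.points i - c) + l (i + 1) • (F.points (i + 1) - c) +
      l (i + 2) • (F.points (i + 2) - c) = 0) {x : E3} (hx : x ∈ F.closedInterior) :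
    ∃ i : Fin 3, ∃ s t : ℝ, 0 ≤ s ∧ 0 ≤ t ∧ s + t ≤ 1 ∧
      x = c + s • (F.points i - c) + t • (F.points (i + 1) - c) := by
  obtain ⟨w, hw1, hw, rfl⟩ := hx
  rw [Finset.affineCombination_eq_linear_combination _ _ _ hw1]
  -- With `k` minimizing `w k / l k`, subtracting this multiple of `∑ lⱼ (Qⱼ - c) = 0` removes the
  -- vertex `k` and keeps the other two coefficients nonnegative.
  obtain ⟨k, hk⟩ := Finite.exists_min fun i ↦ w i / l i
  have hi : k + 1 + 1 = k + 2 := by rw [add_assoc]; rfl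
  have hk0 : 0 ≤ w k / l k := div_nonneg (hw k).1 (hpos k).le
  have hle : ∀ j, 0 ≤ w j - w k / l k * l j := fun j ↦ by
    have := (le_div_iff₀ (hpos j)).1 (hk j)
    linarith
  have hkk : w k / l k * l k = w k := div_mul_cancel₀ _ (hpos k).ne'
  have hls : l k + l (k + 1) + l (k + 2) = 1 := by
    rw [sum_cyclic, Fin.sum_univ_three, hl1]
  rw [← sum_cyclic _ k] at hw1
  rw [← sum_cyclic _ k]
  refine ⟨k + 1, w (k + 1) - w k / l k * l (k + 1), w (k + 2) - w k / l k * l (k + 2),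
    hle _, hle _, by nlinarith, ?_⟩
  rw [hi]
  have e := hl k
  set q := w k / l k
  have hw' : w k = q * l k := hkk.symm
  have hw1' : (1 - w k - w (k + 1) - w (k + 2)) • c = 0 := by
    rw [show 1 - w k - w (k + 1) - w (k + 2) = 0 by linarith, zero_smul]
  rw [hw'] at hw1' ⊢
  linear_combination (norm := module) (-1 : ℝ) • hw1' + q • e

theorem cyclic_sum_eq_zero {F : Triangle} {c : E3} {l : Fin 3 → ℝ} (hl1 : ∑ i, l i = 1)
    (hc : Finset.univ.affineCombination ℝ F.points l = c) (i : Fin 3) :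
    l i • (F.points i - c) + l (i + 1) • (F.points (i + 1) - c) +
      l (i + 2) • (F.points (i + 2) - c) = 0 := by
  have h : ∑ i, l i • (F.points i - c) = 0 := by
    rw [Finset.affineCombination_eq_linear_combination _ _ _ hl1] at hc
    simp only [smul_sub, Finset.sum_sub_distrib, ← Finset.sum_smul]
    rw [hc, hl1, one_smul, sub_self]
  rw [← h]
  exact sum_cyclic (fun i ↦ l i • (F.points i - c)) i

/-- The directions from `c` to the vertices of a face and to an interior point of the tetrahedron
span the space. -/
theorem IsFaceOpposite.eq_of_apply_eq {F : Triangle} {K : Tetrahedron} {m : Fin 4}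
    (h : IsFaceOpposite F K m) {e c : E3} (he : e ∈ K.interior) {L L' : E3 →L[ℝ] ℝ}
    (h1 : ∀ i, L (F.points i - c) = L' (F.points i - c)) (h2 : L (e - c) = L' (e - c)) :
    L = L' := by
  have hD : ∀ j, j ≠ m → (L - L') (K.points j - c) = 0 := by
    intro j hj
    have : K.points j ∈ Set.range F.points := by
      rw [h, Affine.Simplex.range_faceOpposite_points]
      exact ⟨j, hj, rfl⟩
    obtain ⟨i, hi⟩ := this
    rw [← hi, sub_apply, h1, sub_self]
  have hm : (L - L') (K.points m - c) = 0 := by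
    obtain ⟨w, hw1, hw, rfl⟩ := he
    have e0 : (L - L') (∑ j, w j • (K.points j - c)) = 0 := by
      rw [Finset.affineCombination_eq_linear_combination _ _ _ hw1] at h2
      simp only [smul_sub, Finset.sum_sub_distrib, ← Finset.sum_smul]
      rw [hw1, one_smul, sub_apply, h2, sub_self]
    rw [map_sum, Finset.sum_eq_single m (fun j _ hj ↦ by rw [map_smul, hD j hj, smul_zero])
      (by simp), map_smul, smul_eq_mul] at e0
    exact (mul_eq_zero.1 e0).resolve_left (hw m).1.ne'
  have hall : ∀ j, (L - L') (K.points j - c) = 0 := fun j ↦ by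
    by_cases hj : j = m
    · rw [hj, hm]
    · exact hD j hj
  have hspan : Submodule.span ℝ (Set.range fun j : Fin 4 ↦ K.points j - K.points 0) = ⊤ := by
    have := vectorSpan_eq_span_vsub_set_right ℝ (Set.mem_range_self (f := K.points) 0)
    rw [← Set.range_comp, AffineSubspace.vectorSpan_eq_top_of_affineSpan_eq_top ℝ E3 E3
      (K.span_eq_top (by simp))] at this
    exact this.symm
  have : (L : E3 →ₗ[ℝ] ℝ) = L' := by
    refine LinearMap.ext_on hspan ?_
    rintro _ ⟨j, rfl⟩
    have e1 := hall j
    have e2 := hall 0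
    have : (L - L') (K.points j - K.points 0) = 0 := by
      rw [← sub_sub_sub_cancel_right _ _ c, map_sub, e1, e2, sub_zero]
    simpa [sub_eq_zero] using this
  exact ContinuousLinearMap.coe_injective this

theorem exists_smul_of_collinear {c e e' : E3} (h : Collinear ℝ {c, e, e'})
    (he' : e' ≠ c) : ∃ κ : ℝ, e - c = κ • (e' - c) := by
  rw [collinear_iff_of_mem (p₀ := c) (by simp)] at h
  obtain ⟨v, hv⟩ := h
  obtain ⟨r, hr⟩ := hv e (by simp)
  obtain ⟨r', hr'⟩ := hv e' (by simp)
  simp only [vadd_eq_add] at hr hr'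
  have h0' : r' ≠ 0 := by rintro rfl; simp at hr'; exact he' hr'
  refine ⟨r / r', ?_⟩
  rw [hr, hr', add_sub_cancel_right, add_sub_cancel_right, smul_smul, div_mul_cancel₀ _ h0']

theorem Centers.cK_ne_cF {K : Tetrahedron} (c : Centers K) (m : Fin 4) : c.cK ≠ c.cF m :=
  fun h ↦ Set.disjoint_left.1 (K.disjoint_interior_closedInterior_faceOpposite m) c.cK_mem
    (h ▸ (K.faceOpposite m).interior_subset_closedInterior (c.cF_mem m))

/-- The values and the full derivatives of both functions agree on the common face. -/
theorem eq_on_face (Kp Km : Tetrahedron) (F : Triangle) (mp mm : Fin 4)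
    (hFp : IsFaceOpposite F Kp mp) (hFm : IsFaceOpposite F Km mm)
    (cp : Centers Kp) (cm : Centers Km)
    (c : E3) (hcp : cp.cF mp = c) (hcm : cm.cF mm = c)
    (hcol : Collinear ℝ {c, cp.cK, cm.cK}) (fp fm : E3 → ℝ)
    (hfp : IsWF Kp cp fp) (hfm : IsWF Km cm fm) (hdof : FaceDofsAgree F Kp Km fp fm)
    {x : E3} (hx : x ∈ F.closedInterior) :
    fp x = fm x ∧
      fderivWithin ℝ fp Kp.closedInterior x = fderivWithin ℝ fm Km.closedInterior x := by
  obtain ⟨l, hl1, hl01, hlc⟩ := cp.cF_mem_interior hFp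
  rw [hcp] at hlc
  have hl := cyclic_sum_eq_zero hl1 hlc
  rw [Fin.sum_univ_three] at hl1
  obtain ⟨κ, hκ⟩ := exists_smul_of_collinear hcol (hcm ▸ cm.cK_ne_cF mm)
  obtain ⟨a, b, H, hb, hb'⟩ := exists_face_coeffs cp hFp hfp hcp hl
  obtain ⟨a', b', H', hd, hd'⟩ := exists_face_coeffs cm hFm hfm hcm hl
  -- The jumps across the face of the function and of its derivatives, on each of the three
  -- subtriangles. Collinearity of the centres enters here: both transversal directions are parallel,
  -- so the jump of the derivative in the direction `cp.cK - c` is again piecewise quadratic.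
  have J : ∀ i, ∀ s t : ℝ, 0 ≤ s → 0 ≤ t → s + t ≤ 1 →
      ∀ x, x = c + s • (F.points i - c) + t • (F.points (i + 1) - c) →
      fp x - fm x = cubic (a i - a' i) s t ∧
      inner ℝ (grad Kp fp x - grad Km fm x) (F.points i - c) = cubicS (a i - a' i) s t ∧
      inner ℝ (grad Kp fp x - grad Km fm x) (F.points (i + 1) - c) = cubicT (a i - a' i) s t ∧
      inner ℝ (grad Kp fp x - grad Km fm x) (cp.cK - c) = quad (b i - κ • b' i) s t := by
    intro i s t hs ht hst x hx
    obtain ⟨e1, e2, e3, e4⟩ := H i s t hs ht hst x hx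
    obtain ⟨f1, f2, f3, f4⟩ := H' i s t hs ht hst x hx
    simp only [grad_sub_inner, cubic_sub, cubicS_sub, cubicT_sub, quad_sub_smul]
    refine ⟨by rw [e1, f1], by rw [e2, f2], by rw [e3, f3], ?_⟩
    rw [e4, ← f4, hκ, map_smul, smul_eq_mul]
  have h2 : ∀ i : Fin 3, i + 1 + 1 = i + 2 := fun i ↦ by rw [add_assoc]; rfl
  have V : ∀ i, fp (F.points i) - fm (F.points i) = 0 := fun i ↦ sub_eq_zero.2 (hdof.1 i)
  have G : ∀ i, grad Kp fp (F.points i) - grad Km fm (F.points i) = 0 := fun i ↦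
    sub_eq_zero.2 (hdof.2.1 i)
  have J10 : ∀ i, cubic (a i - a' i) 1 0 = 0 ∧ cubicS (a i - a' i) 1 0 = 0 ∧
      cubicT (a i - a' i) 1 0 = 0 ∧ quad (b i - κ • b' i) 1 0 = 0 := fun i ↦ by
    obtain ⟨e1, e2, e3, e4⟩ := J i 1 0 zero_le_one le_rfl (by norm_num) (F.points i) (by simp)
    rw [G, inner_zero_left] at e2 e3 e4
    exact ⟨e1 ▸ V i, e2.symm, e3.symm, e4.symm⟩
  have J01 : ∀ i, cubic (a i - a' i) 0 1 = 0 ∧ cubicS (a i - a' i) 0 1 = 0 ∧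
      cubicT (a i - a' i) 0 1 = 0 ∧ quad (b i - κ • b' i) 0 1 = 0 := fun i ↦ by
    obtain ⟨e1, e2, e3, e4⟩ :=
      J i 0 1 le_rfl zero_le_one (by norm_num) (F.points (i + 1)) (by simp)
    rw [G, inner_zero_left] at e2 e3 e4
    exact ⟨e1 ▸ V (i + 1), e2.symm, e3.symm, e4.symm⟩
  have Jm : ∀ i, cubicS (a i - a' i) (1 / 2) (1 / 2) = 0 ∧
      cubicT (a i - a' i) (1 / 2) (1 / 2) = 0 ∧
      quad (b i - κ • b' i) (1 / 2) (1 / 2) = 0 := fun i ↦ by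
    have hii : i ≠ i + 1 := by revert i; decide
    obtain ⟨-, e2, e3, e4⟩ := J i (1 / 2) (1 / 2) (by norm_num) (by norm_num) (by norm_num)
      (midpoint ℝ (F.points i) (F.points (i + 1)))
      (by rw [midpoint_eq_smul_add]; simp only [invOf_eq_inv]; module)
    have e0 : grad Kp fp (midpoint ℝ (F.points i) (F.points (i + 1))) -
        grad Km fm (midpoint ℝ (F.points i) (F.points (i + 1))) = 0 := by
      refine eq_zero_of_cross_of_inner
        (sub_ne_zero.2 (F.independent.injective.ne hii.symm)) (hdof.cross_midpoint hii) ?_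
      -- The jump restricted to the edge is a cubic with a double zero at either end.
      rw [← sub_sub_sub_cancel_right (F.points (i + 1)) _ c, inner_sub_right, e2, e3]
      obtain ⟨f1, f2, f3, -⟩ := J10 i
      obtain ⟨g1, g2, g3, -⟩ := J01 i
      simp only [cubic, cubicS, cubicT] at f1 f2 f3 g1 g2 g3 ⊢
      norm_num at f1 f2 f3 g1 g2 g3 ⊢
      linarith
    rw [e0, inner_zero_left] at e2 e3 e4
    exact ⟨e2.symm, e3.symm, e4.symm⟩
  have Jc : ∀ i, ∀ t : ℝ, 0 ≤ t → t ≤ 1 →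
      cubic (a i - a' i) 0 t = cubic (a (i + 1) - a' (i + 1)) t 0 ∧
      l i * cubicS (a i - a' i) 0 t + l (i + 1) * cubicT (a i - a' i) 0 t +
        l (i + 2) * cubicT (a (i + 1) - a' (i + 1)) t 0 = 0 ∧
      quad (b i - κ • b' i) 0 t = quad (b (i + 1) - κ • b' (i + 1)) t 0 := by
    intro i t h0 h1
    obtain ⟨e1, e2, e3, e4⟩ := J i 0 t le_rfl h0 (by simpa using h1)
      (c + t • (F.points (i + 1) - c)) (by simp)
    obtain ⟨f1, f2, f3, f4⟩ := J (i + 1) t 0 h0 le_rfl (by simpa using h1)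
      (c + t • (F.points (i + 1) - c)) (by simp)
    refine ⟨e1.symm.trans f1, ?_, e4.symm.trans f4⟩
    rw [h2] at f3
    rw [← e2, ← e3, ← f3, ← real_inner_smul_right, ← real_inner_smul_right,
      ← real_inner_smul_right, ← inner_add_right, ← inner_add_right, hl i, inner_zero_right]
  have za := cubic_eq_zero l hl1 (a - a') (fun i ↦ (J10 i).1) (fun i ↦ (J10 i).2.1)
    (fun i ↦ (J01 i).2.1) (fun i ↦ (J10 i).2.2.1) (fun i ↦ (J01 i).2.2.1) (fun i ↦ (Jm i).1)
    (fun i ↦ (Jm i).2.1) (fun i t h0 h1 ↦ (Jc i t h0 h1).1) (fun i t h0 h1 ↦ (Jc i t h0 h1).2.1)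
  have zb := quad_eq_zero l hl1 (b - κ • b') (fun i ↦ (J10 i).2.2.2) (fun i ↦ (J01 i).2.2.2)
    (fun i ↦ (Jm i).2.2) (fun i t h0 h1 ↦ (Jc i t h0 h1).2.2)
    (fun i ↦ by
      simp only [Pi.sub_apply, Pi.smul_apply, smul_eq_mul]
      linear_combination hb i - κ * hd i)
    (fun i ↦ by
      simp only [Pi.sub_apply, Pi.smul_apply, smul_eq_mul]
      linear_combination hb' i - κ * hd' i)
  obtain ⟨i, s, t, hs, ht, hst, hx⟩ := exists_subtriangle (fun i ↦ (hl01 i).1) hl1 hl hx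
  obtain ⟨e1, e2, e3, e4⟩ := J i s t hs ht hst x hx
  rw [show a i - a' i = 0 from congrFun za i] at e1 e2 e3
  rw [show b i - κ • b' i = 0 from congrFun zb i] at e4
  rw [grad_sub_inner] at e2 e3 e4
  simp only [cubic, cubicS, cubicT, quad, Pi.zero_apply, mul_zero, zero_mul, add_zero,
    sub_eq_zero] at e1 e2 e3 e4
  refine ⟨e1, hFp.eq_of_apply_eq cp.cK_mem (c := c) (fun j ↦ ?_) e4⟩
  have hj : j = i ∨ j = i + 1 ∨ j = i + 2 :=
    (show ∀ i j : Fin 3, j = i ∨ j = i + 1 ∨ j = i + 2 by decide) i j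
  rcases hj with rfl | rfl | rfl
  · exact e2
  · exact e3
  · have e := hl i
    have hne := (hl01 (i + 2)).1.ne'
    have e5 := congrArg (fderivWithin ℝ fp Kp.closedInterior x) e
    have e6 := congrArg (fderivWithin ℝ fm Km.closedInterior x) e
    simp only [map_add, map_smul, map_zero, smul_eq_mul] at e5 e6
    rw [e2, e3] at e5
    exact mul_left_cancel₀ hne (by linarith)

end WorseyFarin

theorem mainTheorem2
    (Kp Km : WorseyFarin.Tetrahedron) (F : WorseyFarin.Triangle) (mp mm : Fin 4)
    (hFp : WorseyFarin.IsFaceOpposite F Kp mp)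
    (hFm : WorseyFarin.IsFaceOpposite F Km mm)
    (hF : Kp.closedInterior ∩ Km.closedInterior = F.closedInterior)
    (cp : WorseyFarin.Centers Kp) (cm : WorseyFarin.Centers Km)
    (c_F : WorseyFarin.E3) (hcp : cp.cF mp = c_F) (hcm : cm.cF mm = c_F)
    (hcol : Collinear ℝ {c_F, cp.cK, cm.cK})
    (fp fm : WorseyFarin.E3 → ℝ)
    (hfp : WorseyFarin.IsWF Kp cp fp) (hfm : WorseyFarin.IsWF Km cm fm)
    (hdof : WorseyFarin.FaceDofsAgree F Kp Km fp fm) :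
    ∃ f : WorseyFarin.E3 → ℝ,
      Set.EqOn f fp Kp.closedInterior ∧ Set.EqOn f fm Km.closedInterior ∧
      ContDiffOn ℝ 1 f (Kp.closedInterior ∪ Km.closedInterior) := by
  classical
  have key := fun x hx ↦ WorseyFarin.eq_on_face Kp Km F mp mm hFp hFm cp cm c_F hcp hcm hcol fp fm
    hfp hfm hdof (x := x) (hF ▸ hx)
  exact ⟨Kp.closedInterior.piecewise fp fm, Set.piecewise_eqOn _ _ _,
    WorseyFarin.eqOn_piecewise_right fun x hx ↦ (key x hx).1,
    WorseyFarin.contDiffOn_one_piecewise_union Kp.isClosed_closedInterior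
      Km.isClosed_closedInterior (WorseyFarin.uniqueDiffOn_closedInterior Kp)
      (WorseyFarin.uniqueDiffOn_closedInterior Km) hfp.1 hfm.1 (fun x hx ↦ (key x hx).1)
      fun x hx ↦ (key x hx).2⟩
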